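/- Let $n\ge 2$ and let $N=\{1,\dots,n,-n,\dots,-1\}$ be totally ordered by $1\lessdot 2\lessdot\dots\lessdot n\lessdot -n\lessdot\dots\lessdot -2\lessdot -1$. Let $P$ be the set of pairs $(i,j)$ with $i\in[1,n]$ and $j\in[i,n]\cup[-n,-i]$ (the type C Gelfand--Tsetlin poset), and let $\mathbb C[P]=\mathbb C[z_{i,j}]_{(i,j)\in P}$. Let $S=\mathbb C[X_{i_1,\dots,i_k}]$ be the polynomial ring with one variable for each $k\in[1,n]$ and each tuple $i_1\lessdot\dots\lessdot i_k$ of elements of $N$; it is the multihomogeneous coordinate ring of $\mathbb P(\wedge^1\mathbb C^N)\times\dots\times\mathbb P(\wedge^n\mathbb C^N)$, with $X_{i_1,\dots,i_k}$ dual to $e_{i_1}\wedge\dots\wedge e_{i_k}$. Let $I_{\mathrm A}\subset S$ be the Plücker ideal of the variety of flags $V_1\subset\dots\subset V_n\subset\mathbb C^N$ with $\dim V_k=k$, that is, the ideal of all polynomials in $S$ that vanish at every vector of multihomogeneous Plücker coordinates of every such flag. A tuple $(i_1,\dots,i_k)$ of elements of $N$ is called admissible if for every $l\in[1,n]$ the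 number of indices $j$ with $|i_j|\le l$ is at most $l$. Let $\Theta$ be the set of admissible tuples $(i_1\lessdot\dots\lessdot i_k)$ with $k\in[1,n]$, let $\mathbb C[\Theta]=\mathbb C[X_{i_1,\dots,i_k}]_{(i_1,\dots,i_k)\in\Theta}$, and let $\pi:S\to\mathbb C[\Theta]$ be the surjective $\mathbb C$-algebra homomorphism that fixes the variables indexed by $\Theta$ and sends all other variables to $0$. Put $\widetilde I=\pi(I_{\mathrm A})$. Let $Z$ be the $n\times 2n$ matrix with rows indexed by $[1,n]$ and columns indexed by $N$ such that $Z_{i,j}=z_{i,j}$ if $(i,j)\in P$ and $Z_{i,j}=0$ otherwise, and let $D_{i_1,\dots,i_k}$ be the minor of $Z$ in rows $1,\dots,k$ and columns $i_1,\dots,i_k$. Then $\widetilde I$ is the kernel of the $\mathbb C$-algebra homomorphism $\mathbb C[\Theta]\to\mathbb C[P]$ that maps $X_{i_1,\dots,i_k}$ to $D_{i_1,\dots,i_k}$. -/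

import Mathlib

noncomputable section

namespace TypeCFlag

/-- The set `N = {1, …, n, -n, …, -1}` of nonzero integers of absolute value at most `n`. -/
@[ext]
structure Idx (n : ℕ) where
  val : ℤ
  ne_zero : val ≠ 0
  abs_le : |val| ≤ n

/-- The position (from `1` to `2n`) of an element in the list `1, …, n, -n, …, -1`. -/
def Idx.pos {n : ℕ} (j : Idx n) : ℤ :=
  if 0 < j.val then j.val else 2 * n + 1 + j.val

theorem Idx.pos_injective {n : ℕ} : Function.Injective (Idx.pos (n := n)) := by
  intro a b h
  obtain ⟨a, ha, ha'⟩ := a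
  obtain ⟨b, hb, hb'⟩ := b
  rw [_root_.abs_le] at ha' hb'
  simp only [Idx.pos] at h
  ext
  simp only
  split_ifs at h <;> omega

/-- The total order `1 < 2 < ⋯ < n < -n < ⋯ < -2 < -1` on `N`. -/
instance (n : ℕ) : LinearOrder (Idx n) := LinearOrder.lift' Idx.pos Idx.pos_injective

/-- The type C Gelfand–Tsetlin poset `P`: pairs `(i, j)` with `i ∈ [1, n]` and
`j ∈ [i, n] ∪ [-n, -i]`. The row `i ∈ [1, n]` is encoded by the element `i - 1` of `Fin n`.
The order inherited from the product is the one of the poset. -/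
abbrev GTPoset (n : ℕ) : Type :=
  {p : Fin n × Idx n // (p.1 : ℤ) + 1 ≤ p.2.val ∨ p.2.val ≤ -((p.1 : ℤ) + 1)}

/-- Increasing tuples `(i_1 < ⋯ < i_m)` in `N` with `m ∈ [1, n]`; the first component is `m - 1`. -/
abbrev Tuple (n : ℕ) : Type := Σ k : Fin n, (Fin (k + 1) ↪o Idx n)

/-- A tuple is admissible if for every `l ∈ [1, n]` at most `l` of its entries have absolute value
at most `l`. -/
def Admissible {n m : ℕ} (t : Fin m → Idx n) : Prop :=
  ∀ l : ℕ, 1 ≤ l → l ≤ n → (Finset.univ.filter fun c : Fin m => |(t c).val| ≤ (l : ℤ)).card ≤ l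

/-- The set `Θ` of admissible increasing tuples. -/
abbrev Theta (n : ℕ) : Type := {t : Tuple n // Admissible t.2}

/-- A flag `V_1 ⊂ ⋯ ⊂ V_n` of subspaces of `ℂ^N` with `dim V_m = m`;
`subspace k` is `V_{k+1}`. -/
structure PartialFlag (n : ℕ) where
  subspace : Fin n → Submodule ℂ (Idx n → ℂ)
  mono : Monotone subspace
  finrank_eq : ∀ k : Fin n, Module.finrank ℂ (subspace k) = k + 1

/-- `p` is a vector of multihomogeneous Plücker coordinates of the flag `F`: for each `k`, the
component of `p` in `⋀^{k+1} ℂ^N` is `b_0 ∧ ⋯ ∧ b_k` for some basis `b` of `F.subspace k`, the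
coordinate of which at `e_{t_0} ∧ ⋯ ∧ e_{t_k}` is the determinant of the matrix `b_a (t_c)`.
Replacing `b` by another basis multiplies the component by an arbitrary nonzero scalar, so all
representatives of the point of the product of projective spaces occur. -/
def IsPluckerVector {n : ℕ} (F : PartialFlag n) (p : Tuple n → ℂ) : Prop :=
  ∀ k : Fin n, ∃ b : Module.Basis (Fin (k + 1)) ℂ (F.subspace k),
    ∀ t : Fin (k + 1) ↪o Idx n,
      p ⟨k, t⟩ = (Matrix.of fun a c : Fin (k + 1) => (b a : Idx n → ℂ) (t c)).det

/-- The Plücker ideal `I_A` of the variety of partial flags of signature `(1, …, n)` in `ℂ^N`: the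
ideal of all polynomials in `S = ℂ[X_{i_1,…,i_m}]` that vanish at all multihomogeneous coordinate
vectors of all flags. -/
def pluckerIdeal (n : ℕ) : Ideal (MvPolynomial (Tuple n) ℂ) :=
  MvPolynomial.vanishingIdeal ℂ {p | ∃ F : PartialFlag n, IsPluckerVector F p}

open Classical in
/-- The surjection `π : S → ℂ[Θ]` that fixes the variables in `ℂ[Θ]` and sends the others to `0`. -/
def proj (n : ℕ) : MvPolynomial (Tuple n) ℂ →ₐ[ℂ] MvPolynomial (Theta n) ℂ :=
  MvPolynomial.aeval fun t =>
    if h : Admissible t.2 then MvPolynomial.X (⟨t, h⟩ : Theta n) else 0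

theorem proj_surjective (n : ℕ) : Function.Surjective (proj n) := by
  intro f
  refine ⟨MvPolynomial.rename Subtype.val f, ?_⟩
  rw [proj, MvPolynomial.aeval_rename]
  conv_rhs => rw [← MvPolynomial.aeval_X_left_apply f]
  congr 2
  funext t
  simp [t.2]

/-- The ideal `Ĩ = π(I_A)` of `ℂ[Θ]`. -/
def intermediateIdeal (n : ℕ) : Ideal (MvPolynomial (Theta n) ℂ) :=
  (pluckerIdeal n).map (proj n)

/-- The ideal `Ĩ` is the image of the set `I_A`. -/
theorem coe_intermediateIdeal (n : ℕ) :
    (intermediateIdeal n : Set (MvPolynomial (Theta n) ℂ)) = proj n '' pluckerIdeal n := by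
  ext f
  exact Ideal.mem_map_iff_of_surjective (proj n) (proj_surjective n)

open Classical in
/-- The `n × 2n` matrix `Z` with `Z_{i,j} = z_{i,j}` if `(i, j) ∈ P` and `Z_{i,j} = 0` otherwise. -/
def matrixZ (n : ℕ) : Matrix (Fin n) (Idx n) (MvPolynomial (GTPoset n) ℂ) :=
  Matrix.of fun i j =>
    if h : (i : ℤ) + 1 ≤ j.val ∨ j.val ≤ -((i : ℤ) + 1) then
      MvPolynomial.X (⟨(i, j), h⟩ : GTPoset n)
    else 0

/-- The minor `D_{i_1,…,i_m}` of `Z` in rows `1, …, m` and columns `i_1, …, i_m`. -/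
def minorD (n : ℕ) (t : Tuple n) : MvPolynomial (GTPoset n) ℂ :=
  ((matrixZ n).submatrix (Fin.castLE t.1.isLt) t.2).det

/-- The homomorphism `ℂ[Θ] → ℂ[P]`, `X_{i_1,…,i_m} ↦ D_{i_1,…,i_m}`. -/
def minorHom (n : ℕ) : MvPolynomial (Theta n) ℂ →ₐ[ℂ] MvPolynomial (GTPoset n) ℂ :=
  MvPolynomial.aeval fun t => minorD n t.1

end TypeCFlag

end

/-! Order `N` by 1, -1, 2, -2, …, n, -n. Since `Z` has a nonzero entry at (i, j) exactly when |j| ≥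
i, the minor of an inadmissible tuple is zero (`minorD_eq_zero`), so the map X ↦ D on all of S
factors through π. Where the rows of `Z` are independent, its minors are Plücker coordinates of a
flag; hence they satisfy every relation in I_A (`aeval_minorD_of_mem_pluckerIdeal`), and Ĩ lies in
the kernel.

For the converse, straightening shows that standard monomials, the semistandard tableaux for this
order, span S modulo I_A (`monomial_mem_sup_span_standard`). For an admissible tuple sorted in this
order, the diagonal term of the minor is nonzero and strictly heaviest (`isLead_minorD`). A product
of diagonal terms records the row contents of a tableau, and these determine a semistandard tableau.
So the images of standard monomials in admissible variables are linearly independent. If π(f) is in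
the kernel, replace f modulo I_A by a standard combination g: its coefficients at admissible
monomials vanish, π kills its other monomials, and π(f) = π(f - g) lies in Ĩ. -/

namespace TypeCFlag

open MvPolynomial Equiv

variable {n : ℕ}

/-! ### The order 1, -1, 2, -2, … and semistandard columns -/

/-- The rank of an element of `N` in the order `1, -1, 2, -2, …, n, -n`. -/
def kingPos (j : Idx n) : ℕ := 2 * j.val.natAbs + if 0 < j.val then 0 else 1

theorem kingPos_injective : Function.Injective (kingPos (n := n)) := by
  rintro ⟨a, ha, ha'⟩ ⟨b, hb, hb'⟩ h
  simp only [kingPos] at h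
  ext
  simp only
  split_ifs at h <;> omega

theorem kingPos_le (j : Idx n) : kingPos j ≤ 2 * n + 1 := by
  obtain ⟨a, ha, ha'⟩ := j
  rw [Int.abs_eq_natAbs] at ha'
  simp only [kingPos]
  split_ifs <;> omega

theorem abs_le_of_kingPos_le {i j : Idx n} (h : kingPos i ≤ kingPos j) : |i.val| ≤ |j.val| := by
  rw [Int.abs_eq_natAbs, Int.abs_eq_natAbs]
  simp only [kingPos] at h
  split_ifs at h <;> omega

/-- The entries of a tuple, rearranged increasingly with respect to `kingPos`. -/
noncomputable def sortedCol (t : Tuple n) : Fin (t.1 + 1) → Idx n :=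
  t.2 ∘ _root_.Tuple.sort (kingPos ∘ t.2)

theorem strictMono_sortedCol (t : Tuple n) : StrictMono (kingPos ∘ sortedCol t) :=
  (_root_.Tuple.monotone_sort (kingPos ∘ t.2)).strictMono_of_injective
    (kingPos_injective.comp (t.2.injective.comp (Equiv.injective _)))

theorem range_sortedCol (t : Tuple n) : Set.range (sortedCol t) = Set.range t.2 :=
  (Equiv.surjective _).range_comp _

/-- The order of columns in a semistandard tableau: `t` may stand to the left of `s`. -/
def Precedes (t s : Tuple n) : Prop :=
  s.1 ≤ t.1 ∧ ∀ (r : ℕ) (ht : r < t.1 + 1) (hs : r < s.1 + 1),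
    kingPos (sortedCol t ⟨r, ht⟩) ≤ kingPos (sortedCol s ⟨r, hs⟩)

theorem Precedes.refl (t : Tuple n) : Precedes t t := ⟨le_rfl, fun _ _ _ => le_rfl⟩

theorem Precedes.trans {t s u : Tuple n} (h : Precedes t s) (h' : Precedes s u) : Precedes t u :=
  ⟨h'.1.trans h.1, fun r ht hu =>
    (h.2 r ht (hu.trans_le (by have := h'.1; simpa using this))).trans (h'.2 r _ hu)⟩

theorem Precedes.antisymm {t s : Tuple n} (h : Precedes t s) (h' : Precedes s t) : t = s := by
  have hk := le_antisymm h'.1 h.1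
  have hr : Set.range t.2 = Set.range s.2 := by
    rw [← range_sortedCol, ← range_sortedCol]
    ext x
    constructor
    · rintro ⟨⟨r, hr⟩, rfl⟩
      exact ⟨⟨r, hk ▸ hr⟩, kingPos_injective (le_antisymm (h'.2 r _ _) (h.2 r _ _))⟩
    · rintro ⟨⟨r, hr⟩, rfl⟩
      exact ⟨⟨r, hk ▸ hr⟩, kingPos_injective (le_antisymm (h.2 r _ _) (h'.2 r _ _))⟩
  obtain ⟨k, t⟩ := t
  obtain ⟨l, s⟩ := s
  obtain rfl : k = l := hk
  congr 1
  exact DFunLike.coe_injective ((StrictMono.range_inj t.strictMono s.strictMono).1 hr)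

/-! ### Plücker variables of arbitrary sequences -/

/-- The increasing tuple with the entries of an injective sequence. -/
noncomputable def toTuple (k : Fin n) (w : Fin (k + 1) → Idx n) (hw : Function.Injective w) :
    Tuple n :=
  ⟨k, OrderEmbedding.ofStrictMono (w ∘ _root_.Tuple.sort w)
    ((_root_.Tuple.monotone_sort w).strictMono_of_injective (hw.comp (Equiv.injective _)))⟩

open Classical in
/-- The Plücker variable of an arbitrary sequence of elements of `N`: alternating in the sequence,
and zero if an entry is repeated. -/
noncomputable def plucker (k : Fin n) (w : Fin (k + 1) → Idx n) : MvPolynomial (Tuple n) ℂ :=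
  if hw : Function.Injective w then
    ((Perm.sign (_root_.Tuple.sort w) : ℤ) : MvPolynomial (Tuple n) ℂ) * X (toTuple k w hw)
  else 0

theorem sign_mul_self_cast {α R : Type*} [Fintype α] [DecidableEq α] [Ring R] (σ : Perm α) :
    ((Perm.sign σ : ℤ) : R) * ((Perm.sign σ : ℤ) : R) = 1 := by
  rw [← Int.cast_mul, ← Units.val_mul, Int.units_mul_self]; simp

theorem plucker_comp_perm (k : Fin n) (w : Fin (k + 1) → Idx n) (τ : Perm (Fin (k + 1))) :
    plucker k (w ∘ τ) = ((Perm.sign τ : ℤ) : MvPolynomial (Tuple n) ℂ) * plucker k w := by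
  classical
  by_cases hw : Function.Injective w
  · have hw' : Function.Injective (w ∘ τ) := hw.comp τ.injective
    have hs : (w ∘ τ) ∘ _root_.Tuple.sort (w ∘ τ) = w ∘ _root_.Tuple.sort w :=
      _root_.Tuple.comp_perm_comp_sort_eq_comp_sort
    have ht : toTuple k (w ∘ τ) hw' = toTuple k w hw := by
      simp only [toTuple, hs]
    have hp : τ * _root_.Tuple.sort (w ∘ τ) = _root_.Tuple.sort w :=
      Equiv.ext fun x => hw (congrFun hs x)
    rw [plucker, plucker, dif_pos hw, dif_pos hw', ht, ← hp, Perm.sign_mul, Units.val_mul,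
      Int.cast_mul, ← mul_assoc, ← mul_assoc, sign_mul_self_cast, one_mul]
  · rw [plucker, plucker, dif_neg hw, dif_neg, mul_zero]
    rwa [τ.injective_comp]

theorem plucker_orderEmbedding (k : Fin n) (t : Fin (k + 1) ↪o Idx n) :
    plucker k t = X ⟨k, t⟩ := by
  have hs : _root_.Tuple.sort t = Equiv.refl _ :=
    _root_.Tuple.sort_eq_refl_iff_monotone.2 t.monotone
  rw [plucker, dif_pos t.injective, hs]
  simp only [toTuple, hs]
  simp
  rfl

theorem plucker_sortedCol (t : Tuple n) :
    plucker t.1 (sortedCol t) =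
      ((Perm.sign (_root_.Tuple.sort (kingPos ∘ t.2)) : ℤ) : MvPolynomial (Tuple n) ℂ) * X t := by
  rw [sortedCol, plucker_comp_perm, plucker_orderEmbedding]

/-- A family of values at the increasing tuples which comes from minors gives the minors at all
sequences. -/
theorem aeval_plucker {R : Type*} [CommRing R] [Algebra ℂ R] (p : Tuple n → R) (k : Fin n)
    (A : Fin (k + 1) → Idx n → R)
    (hp : ∀ t : Fin (k + 1) ↪o Idx n, p ⟨k, t⟩ = (Matrix.of fun a c => A a (t c)).det)
    (w : Fin (k + 1) → Idx n) :
    aeval p (plucker k w) = (Matrix.of fun a c => A a (w c)).det := by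
  classical
  by_cases hw : Function.Injective w
  · rw [plucker, dif_pos hw, map_mul, map_intCast, aeval_X, toTuple, hp]
    have := Matrix.det_permute' (_root_.Tuple.sort w) (Matrix.of fun a c => A a (w c))
    change Matrix.det (Matrix.of fun a c => A a (w (_root_.Tuple.sort w c))) = _ at this
    simp only [OrderEmbedding.coe_ofStrictMono, Function.comp_apply]
    rw [this, ← mul_assoc, sign_mul_self_cast, one_mul]
  · rw [plucker, dif_neg hw, map_zero]
    simp only [Function.Injective, not_forall] at hw
    obtain ⟨a, b, hab, hne⟩ := hw
    exact (Matrix.det_zero_of_column_eq hne fun i => by simp [hab]).symm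

/-! ### Shuffle relations and straightening -/

/-- The shuffle relation: alternating a product of two Plücker variables over more positions than
the length of the longer one gives an element of the Plücker ideal. -/
theorem sum_shuffle_mem_pluckerIdeal (k l : Fin n) (hlk : l ≤ k)
    (w : Fin (k + 1) ⊕ Fin (l + 1) → Idx n) (U : Fin (k + 1) ⊕ Fin (l + 1) → Prop)
    [DecidablePred U] (hU : (k : ℕ) + 1 < Fintype.card {x // U x}) :
    ∑ σ : Perm {x // U x}, ((Perm.sign σ : ℤ) : MvPolynomial (Tuple n) ℂ) *
      (plucker k (w ∘ Perm.ofSubtype σ ∘ Sum.inl) * plucker l (w ∘ Perm.ofSubtype σ ∘ Sum.inr)) ∈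
        pluckerIdeal n := by
  rw [pluckerIdeal, mem_vanishingIdeal_iff]
  rintro p ⟨F, hF⟩
  obtain ⟨b, hb⟩ := hF k
  obtain ⟨b', hb'⟩ := hF l
  let v : Idx n → Fin (k + 1) → ℂ := fun x a => (b a : Idx n → ℂ) x
  -- The smaller subspace lies in the larger one, so its basis is expressed through `b`. Both minors
  -- thereby become multilinear functions of the vectors `v x` in ℂ^(k+1).
  let M : Matrix (Fin (l + 1)) (Fin (k + 1)) ℂ :=
    Matrix.of fun a c => b.repr ⟨b' a, F.mono hlk (b' a).2⟩ c
  have hM : ∀ a x, (b' a : Idx n → ℂ) x = M.mulVecLin (v x) a := by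
    intro a x
    have := congrArg (fun y : F.subspace k => (y : Idx n → ℂ) x)
      (b.sum_repr ⟨b' a, F.mono hlk (b' a).2⟩)
    simp only [AddSubmonoidClass.coe_finsetSum, SetLike.val_smul, Finset.sum_apply, Pi.smul_apply,
      smul_eq_mul] at this
    rw [← this]
    simp [M, v, Matrix.mulVec, dotProduct]
  let Ψ : MultilinearMap ℂ (fun _ : Fin (k + 1) ⊕ Fin (l + 1) => Fin (k + 1) → ℂ) ℂ :=
    (LinearMap.mul' ℂ ℂ).compMultilinearMap (MultilinearMap.domCoprod
      (Matrix.detRowAlternating (n := Fin (k + 1)) (R := ℂ)).toMultilinearMap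
      ((Matrix.detRowAlternating (n := Fin (l + 1)) (R := ℂ)).toMultilinearMap.compLinearMap
        fun _ => M.mulVecLin))
  have hΨ : ∀ u : Fin (k + 1) ⊕ Fin (l + 1) → Idx n,
      aeval p (plucker k (u ∘ Sum.inl) * plucker l (u ∘ Sum.inr)) = Ψ fun x => v (u x) := by
    intro u
    rw [map_mul, aeval_plucker p k _ hb, aeval_plucker p l _ hb', ← Matrix.det_transpose,
      ← Matrix.det_transpose (Matrix.of _)]
    simp only [Ψ, LinearMap.compMultilinearMap_apply, MultilinearMap.domCoprod_apply,
      LinearMap.mul'_apply, hM]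
    rfl
  let m := Ψ.domDomRestrict U fun x => v (w x)
  -- An alternating form in more than k + 1 vectors of a space of dimension k + 1 vanishes.
  have h0 : MultilinearMap.alternatization m (fun x => v (w x)) = 0 := by
    apply AlternatingMap.map_linearDependent
    intro h
    have := h.fintype_card_le_finrank
    rw [Module.finrank_fin_fun] at this
    omega
  rw [map_sum, ← h0, MultilinearMap.alternatization_apply]
  refine Finset.sum_congr rfl fun σ _ => ?_
  rw [map_mul, map_intCast, ← Function.comp_assoc, ← Function.comp_assoc, hΨ, Units.smul_def,
    zsmul_eq_mul, MultilinearMap.domDomCongr_apply, MultilinearMap.domDomRestrict_apply]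
  congr 2
  funext x
  by_cases hx : U x
  · simp [hx, Perm.ofSubtype_apply_of_mem σ hx]
  · simp [hx, Perm.ofSubtype_apply_of_not_mem σ hx]

/-- The squares of these numbers measure the progress of straightening. -/
def level (t : Tuple n) : ℤ :=
  (n * (2 * n + 1) + 1) * (t.1 + 1) - ∑ c, (kingPos (t.2 c) : ℤ)

theorem sum_kingPos_le (t : Tuple n) : ∑ c, (kingPos (t.2 c) : ℤ) ≤ n * (2 * n + 1) := by
  calc ∑ c, (kingPos (t.2 c) : ℤ) ≤ ∑ _c : Fin (t.1 + 1), ((2 * n + 1 : ℕ) : ℤ) :=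
        Finset.sum_le_sum fun c _ => by exact_mod_cast kingPos_le _
    _ = ((t.1 + 1 : ℕ) : ℤ) * ((2 * n + 1 : ℕ) : ℤ) := by simp
    _ ≤ n * (2 * n + 1) := by
        have : ((t.1 + 1 : ℕ) : ℤ) ≤ n := by exact_mod_cast t.1.isLt
        push_cast at this ⊢
        gcongr

theorem level_nonneg (t : Tuple n) : 0 ≤ level t := by
  have h := sum_kingPos_le t
  have h2 : (0 : ℤ) ≤ (n * (2 * n + 1) + 1) * t.1 := by positivity
  rw [level]
  linarith

theorem level_le (t : Tuple n) : level t ≤ (n * (2 * n + 1) + 1) * n := by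
  have h : (0 : ℤ) ≤ ∑ c, (kingPos (t.2 c) : ℤ) := by positivity
  have h2 : ((t.1 + 1 : ℕ) : ℤ) ≤ n := by exact_mod_cast t.1.isLt
  have h3 : ((n : ℤ) * (2 * n + 1) + 1) * ((t.1 + 1 : ℕ) : ℤ) ≤ (n * (2 * n + 1) + 1) * n := by
    gcongr
  push_cast at h3
  rw [level]
  linarith

/-- The factor n(2n+1) + 1 in `level` exceeds every sum of `kingPos` over a tuple, so comparing
levels compares lengths first. -/
theorem fst_le_of_level_le {t s : Tuple n} (h : level s ≤ level t) : s.1 ≤ t.1 := by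
  by_contra! hlt
  have h1 := sum_kingPos_le s
  have h2 : (0 : ℤ) ≤ ∑ c, (kingPos (t.2 c) : ℤ) := by positivity
  have h3 : ((t.1 : ℕ) : ℤ) + 1 ≤ (s.1 : ℕ) := by exact_mod_cast hlt
  have h4 : ((n : ℤ) * (2 * n + 1) + 1) * (((t.1 : ℕ) : ℤ) + 1) ≤
    (n * (2 * n + 1) + 1) * ((s.1 : ℕ) : ℤ) := by gcongr
  rw [level, level] at h
  linarith

theorem level_toTuple (k : Fin n) (w : Fin (k + 1) → Idx n) (hw : Function.Injective w) :
    level (toTuple k w hw) = (n * (2 * n + 1) + 1) * (k + 1) - ∑ c, (kingPos (w c) : ℤ) := by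
  simp only [level, toTuple]
  congr 1
  exact Equiv.sum_comp (_root_.Tuple.sort w) fun c => (kingPos (w c) : ℤ)

theorem level_eq_sortedCol (t : Tuple n) :
    level t = (n * (2 * n + 1) + 1) * (t.1 + 1) - ∑ c, (kingPos (sortedCol t c) : ℤ) := by
  rw [level]
  congr 1
  exact (Equiv.sum_comp (_root_.Tuple.sort (kingPos ∘ t.2)) fun c => (kingPos (t.2 c) : ℤ)).symm

/-- If a permutation moves only large elements on the left and only small elements on the right,
and moves some element across, then it decreases the sum of the left side. -/
theorem sum_inl_comp_perm_lt {α β : Type*} [Fintype α] [Fintype β] (f : α ⊕ β → ℤ)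
    (σ : Perm (α ⊕ β)) (θ : ℤ) (hl : ∀ a, σ (Sum.inl a) ≠ Sum.inl a → θ ≤ f (Sum.inl a))
    (hr : ∀ b, σ (Sum.inr b) ≠ Sum.inr b → f (Sum.inr b) < θ)
    (hσ : ∃ a b, σ (Sum.inl a) = Sum.inr b) :
    ∑ a, f (σ (Sum.inl a)) < ∑ a, f (Sum.inl a) := by
  let ind : α ⊕ β → ℤ := Sum.elim (fun _ => 1) (fun _ => 0)
  -- After reindexing by `σ⁻¹` the comparison is termwise: elements that leave the left side have f
  -- ≥ θ, and elements that enter it have f < θ.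
  have key : ∑ x, ind x * (f (σ x) - θ) < ∑ x, ind x * (f x - θ) := by
    rw [← Equiv.sum_comp σ⁻¹ fun x => ind x * (f (σ x) - θ)]
    have hinv : ∀ x, σ (σ⁻¹ x) = x := σ.apply_symm_apply
    simp only [hinv]
    have ind_le : ∀ x, ind x ≤ 1 := by rintro (a | b) <;> simp [ind]
    have ind_nonneg : ∀ x, 0 ≤ ind x := by rintro (a | b) <;> simp [ind]
    apply Finset.sum_lt_sum
    · intro x _
      by_cases hx : σ x = x
      · rw [Perm.inv_eq_iff_eq.2 hx.symm]
      · rcases x with a | b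
        · have := hl a hx
          exact mul_le_mul_of_nonneg_right (ind_le _) (by linarith)
        · have := hr b hx
          exact mul_le_mul_of_nonpos_right (ind_nonneg _) (by linarith)
    · obtain ⟨a, b, hab⟩ := hσ
      refine ⟨Sum.inr b, Finset.mem_univ _, ?_⟩
      have hb : σ (Sum.inr b) ≠ Sum.inr b := fun h => by
        have := σ.injective (hab.trans h.symm)
        simp at this
      have := hr b hb
      rw [Perm.inv_eq_iff_eq.2 hab.symm]
      simp only [ind, Sum.elim_inl, Sum.elim_inr]
      linarith
  simp only [Fintype.sum_sum_type, ind, Sum.elim_inl, Sum.elim_inr, zero_mul, one_mul,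
    Finset.sum_const_zero, add_zero, Finset.sum_sub_distrib] at key
  linarith

theorem intCast_mul_mem {R : Type*} [Ring R] [Algebra ℂ R] (Q : Submodule ℂ R) (z : ℤ) {f : R}
    (hf : f ∈ Q) : (z : R) * f ∈ Q := by
  rw [← zsmul_eq_mul]
  exact zsmul_mem hf z

/-- A product of two Plücker variables that is not standard can be exchanged, modulo the Plücker
ideal, for products with a larger sum of squared levels. -/
theorem X_mul_X_mem_of_not_precedes {t s : Tuple n} (hl : level s ≤ level t)
    (h : ¬ Precedes t s) :
    (X t * X s : MvPolynomial (Tuple n) ℂ) ∈ (pluckerIdeal n).restrictScalars ℂ ⊔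
      Submodule.span ℂ {f | ∃ t' s', level t ^ 2 + level s ^ 2 < level t' ^ 2 + level s' ^ 2 ∧
        f = X t' * X s'} := by
  classical
  set Q := (pluckerIdeal n).restrictScalars ℂ ⊔
      Submodule.span ℂ {f | ∃ t' s', level t ^ 2 + level s ^ 2 < level t' ^ 2 + level s' ^ 2 ∧
        f = X t' * X s'}
  have hk := fst_le_of_level_le hl
  simp only [Precedes, hk, true_and, not_forall, not_le] at h
  obtain ⟨r, hrt, hrs, hr⟩ := h
  let w : Fin (t.1 + 1) ⊕ Fin (s.1 + 1) → Idx n := Sum.elim (sortedCol t) (sortedCol s)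
  -- The violation is in row r: alternate over the entries of `t` from row r down and those of `s`
  -- up to row r. These are (t.1 + 1 - r) + (r + 1) = t.1 + 2 positions, one more than the length of
  -- `t`.
  let U : Fin (t.1 + 1) ⊕ Fin (s.1 + 1) → Prop :=
    Sum.elim (fun c => ⟨r, hrt⟩ ≤ c) (fun c => c ≤ ⟨r, hrs⟩)
  have hU : (t.1 : ℕ) + 1 < Fintype.card {x // U x} := by
    rw [Fintype.card_congr (Equiv.subtypeSum (p := U)), Fintype.card_sum,
      Fintype.card_of_subtype (Finset.Ici ⟨r, hrt⟩) (fun x => by simp [U]),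
      Fintype.card_of_subtype (Finset.Iic ⟨r, hrs⟩) (fun x => by simp [U]), Fin.card_Ici,
      Fin.card_Iic]
    simp only
    omega
  have hw : ∀ σ : Perm {x // U x},
      ∑ a, (kingPos (w (Perm.ofSubtype σ (Sum.inl a))) : ℤ) +
        ∑ b, (kingPos (w (Perm.ofSubtype σ (Sum.inr b))) : ℤ) =
      ∑ a, (kingPos (sortedCol t a) : ℤ) + ∑ b, (kingPos (sortedCol s b) : ℤ) := by
    intro σ
    have := Equiv.sum_comp (Perm.ofSubtype σ) fun x => (kingPos (w x) : ℤ)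
    rwa [Fintype.sum_sum_type, Fintype.sum_sum_type] at this
  have hsum := sum_shuffle_mem_pluckerIdeal t.1 s.1 hk w U hU
  rw [← Finset.sum_filter_add_sum_filter_not _ fun σ : Perm {x // U x} =>
    Set.MapsTo (Perm.ofSubtype σ) (Set.range Sum.inl) (Set.range Sum.inl)] at hsum
  -- A permutation that keeps each side in place yields its sign twice, so all such terms equal the
  -- original product.
  have hpres : ∀ σ : Perm {x // U x},
      Set.MapsTo (Perm.ofSubtype σ) (Set.range Sum.inl) (Set.range Sum.inl) →
      ((Perm.sign σ : ℤ) : MvPolynomial (Tuple n) ℂ) *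
        (plucker t.1 (w ∘ Perm.ofSubtype σ ∘ Sum.inl) *
          plucker s.1 (w ∘ Perm.ofSubtype σ ∘ Sum.inr)) =
        plucker t.1 (sortedCol t) * plucker s.1 (sortedCol s) := by
    intro σ hσ
    obtain ⟨⟨α, β⟩, hαβ⟩ := Perm.mem_sumCongrHom_range_of_perm_mapsTo_inl hσ
    have hs : Perm.sign σ = Perm.sign α * Perm.sign β := by
      rw [← Perm.sign_ofSubtype, ← hαβ]
      exact Perm.sign_sumCongr α β
    have h1 : w ∘ Perm.ofSubtype σ ∘ Sum.inl = sortedCol t ∘ α := by rw [← hαβ]; rfl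
    have h2 : w ∘ Perm.ofSubtype σ ∘ Sum.inr = sortedCol s ∘ β := by rw [← hαβ]; rfl
    have hα := sign_mul_self_cast (R := MvPolynomial (Tuple n) ℂ) α
    have hβ := sign_mul_self_cast (R := MvPolynomial (Tuple n) ℂ) β
    rw [h1, h2, plucker_comp_perm, plucker_comp_perm, hs, Units.val_mul, Int.cast_mul]
    linear_combination
      ((Perm.sign β : ℤ) : MvPolynomial (Tuple n) ℂ) ^ 2 * plucker t.1 (sortedCol t) *
        plucker s.1 (sortedCol s) * hα + plucker t.1 (sortedCol t) * plucker s.1 (sortedCol s) * hβ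
  have hnonpres : ∀ σ : Perm {x // U x},
      ¬ Set.MapsTo (Perm.ofSubtype σ) (Set.range Sum.inl) (Set.range Sum.inl) →
      ((Perm.sign σ : ℤ) : MvPolynomial (Tuple n) ℂ) *
        (plucker t.1 (w ∘ Perm.ofSubtype σ ∘ Sum.inl) *
          plucker s.1 (w ∘ Perm.ofSubtype σ ∘ Sum.inr)) ∈ Q := by
    intro σ hσ
    apply intCast_mul_mem
    by_cases h1 : Function.Injective (w ∘ Perm.ofSubtype σ ∘ Sum.inl)
    swap
    · rw [plucker, dif_neg h1, zero_mul]
      exact Q.zero_mem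
    by_cases h2 : Function.Injective (w ∘ Perm.ofSubtype σ ∘ Sum.inr)
    swap
    · rw [mul_comm, plucker, dif_neg h2, zero_mul]
      exact Q.zero_mem
    rw [plucker, plucker, dif_pos h1, dif_pos h2, mul_mul_mul_comm, ← Int.cast_mul]
    apply intCast_mul_mem
    refine (le_sup_right : _ ≤ Q) (Submodule.subset_span ⟨_, _, ?_, rfl⟩)
    -- The movable entries of `s` are at most its entry in row r, which is smaller than every
    -- movable entry of `t`; that entry of `t` is the threshold.
    have hlt := sum_inl_comp_perm_lt (fun x => (kingPos (w x) : ℤ)) (Perm.ofSubtype σ)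
      (kingPos (sortedCol t ⟨r, hrt⟩))
      (fun a ha => by
        have : U (Sum.inl a) := by
          by_contra hc
          exact ha (Perm.ofSubtype_apply_of_not_mem σ hc)
        exact_mod_cast (strictMono_sortedCol t).monotone this)
      (fun b hb => by
        have : U (Sum.inr b) := by
          by_contra hc
          exact hb (Perm.ofSubtype_apply_of_not_mem σ hc)
        exact_mod_cast ((strictMono_sortedCol s).monotone this).trans_lt hr)
      (by
        simp only [Set.MapsTo, Set.mem_range, not_forall] at hσ
        obtain ⟨_, ⟨a, rfl⟩, ha⟩ := hσ
        rcases hx : Perm.ofSubtype σ (Sum.inl a) with c | c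
        · exact absurd ⟨c, hx.symm⟩ ha
        · exact ⟨a, c, hx⟩)
    have hsm := hw σ
    rw [level_toTuple, level_toTuple]
    rw [level_eq_sortedCol, level_eq_sortedCol t] at hl
    rw [level_eq_sortedCol, level_eq_sortedCol s]
    simp only [Function.comp_apply]
    change _ < ∑ a, (kingPos (sortedCol t a) : ℤ) at hlt
    generalize ∑ a, (kingPos (w (Perm.ofSubtype σ (Sum.inl a))) : ℤ) = a' at *
    generalize ∑ a, (kingPos (w (Perm.ofSubtype σ (Sum.inr a))) : ℤ) = b' at *
    generalize ∑ a, (kingPos (sortedCol t a) : ℤ) = a at *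
    generalize ∑ a, (kingPos (sortedCol s a) : ℤ) = b at *
    generalize ((n : ℤ) * (2 * n + 1) + 1) * (t.1 + 1) = u at *
    generalize ((n : ℤ) * (2 * n + 1) + 1) * (s.1 + 1) = v at *
    obtain rfl : b' = b + (a - a') := by linarith
    -- With δ = a - a' > 0, the larger level grows by δ and the smaller one drops by δ, so the sum
    -- of squares grows.
    nlinarith [mul_nonneg (sub_nonneg.2 hlt.le) (sub_nonneg.2 hl),
      mul_pos (sub_pos.2 hlt) (sub_pos.2 hlt)]
  rw [Finset.sum_congr rfl fun σ hσ => hpres σ (Finset.mem_filter.1 hσ).2, Finset.sum_const] at hsum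
  have hIQ : ∀ f ∈ pluckerIdeal n, f ∈ Q := fun f hf =>
    (le_sup_left : (pluckerIdeal n).restrictScalars ℂ ≤ Q) hf
  have hmem := hIQ _ hsum
  rw [Submodule.add_mem_iff_left] at hmem
  swap
  · exact Q.sum_mem fun σ hσ => hnonpres σ (Finset.mem_filter.1 hσ).2
  rw [← Nat.cast_smul_eq_nsmul ℂ] at hmem
  -- The original product occurs with this multiplicity, which is positive because the identity is
  -- counted.
  have hne : ((Finset.univ.filter fun σ : Perm {x // U x} =>
      Set.MapsTo (Perm.ofSubtype σ) (Set.range Sum.inl) (Set.range Sum.inl)).card : ℂ) ≠ 0 := by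
    rw [Nat.cast_ne_zero, ← Nat.pos_iff_ne_zero, Finset.card_pos]
    exact ⟨1, by simp [Perm.coe_one]⟩
  rw [Submodule.smul_mem_iff _ hne, plucker_sortedCol, plucker_sortedCol] at hmem
  have hα := sign_mul_self_cast (R := MvPolynomial (Tuple n) ℂ)
    (_root_.Tuple.sort (kingPos ∘ t.2))
  have hβ := sign_mul_self_cast (R := MvPolynomial (Tuple n) ℂ)
    (_root_.Tuple.sort (kingPos ∘ s.2))
  have := intCast_mul_mem Q (Perm.sign (_root_.Tuple.sort (kingPos ∘ t.2)) : ℤ)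
    (intCast_mul_mem Q (Perm.sign (_root_.Tuple.sort (kingPos ∘ s.2)) : ℤ) hmem)
  convert this using 1
  linear_combination (-(X t * X s) : MvPolynomial (Tuple n) ℂ) * hα -
    ((Perm.sign (_root_.Tuple.sort (kingPos ∘ t.2)) : ℤ) : MvPolynomial (Tuple n) ℂ) ^ 2 *
      (X t * X s) * hβ

/-! ### Standard monomials span modulo the Plücker ideal -/

/-- A monomial in the Plücker variables is standard if its columns form a semistandard tableau. -/
def IsStandard (m : Tuple n →₀ ℕ) : Prop :=
  ∀ t ∈ m.support, ∀ s ∈ m.support, Precedes t s ∨ Precedes s t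

/-- The total squared level of a monomial. -/
noncomputable def totalLevel : (Tuple n →₀ ℕ) →+ ℤ :=
  Finsupp.liftAddHom fun t => (AddMonoidHom.mulRight (level t ^ 2)).comp (Nat.castAddMonoidHom ℤ)

theorem totalLevel_single (t : Tuple n) (a : ℕ) :
    totalLevel (Finsupp.single t a) = a * level t ^ 2 := by
  simp [totalLevel]

theorem totalLevel_le (m : Tuple n →₀ ℕ) :
    totalLevel m ≤ m.degree * ((n * (2 * n + 1) + 1) * n) ^ 2 := by
  induction m using Finsupp.induction_linear with
  | zero => simp
  | add f g hf hg => rw [map_add, map_add]; push_cast; linarith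
  | single t a =>
    rw [totalLevel_single, Finsupp.degree_single]
    have := level_nonneg t
    gcongr
    exact level_le t

/-- Standard monomials span the coordinate ring modulo the Plücker ideal. -/
theorem monomial_mem_sup_span_standard (m : Tuple n →₀ ℕ) :
    monomial m (1 : ℂ) ∈ (pluckerIdeal n).restrictScalars ℂ ⊔
      Submodule.span ℂ ((fun m => monomial m (1 : ℂ)) '' {m : Tuple n →₀ ℕ | IsStandard m}) := by
  set Q := (pluckerIdeal n).restrictScalars ℂ ⊔
      Submodule.span ℂ ((fun m => monomial m (1 : ℂ)) '' {m : Tuple n →₀ ℕ | IsStandard m})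
  -- An exchange keeps the degree and raises `totalLevel`, which is bounded in terms of the degree;
  -- induct on the gap to this bound.
  induction hN : (m.degree * ((n * (2 * n + 1) + 1) * n) ^ 2 - totalLevel m : ℤ).toNat using
    Nat.strong_induction_on generalizing m with
  | _ N ih =>
  by_cases hm : IsStandard m
  · exact (le_sup_right : _ ≤ Q) (Submodule.subset_span ⟨m, hm, rfl⟩)
  obtain ⟨t, ht, s, hs, hl, hts, hne⟩ : ∃ t, t ∈ m.support ∧ ∃ s, s ∈ m.support ∧
      level s ≤ level t ∧ ¬ Precedes t s ∧ t ≠ s := by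
    simp only [IsStandard, not_forall, not_or] at hm
    obtain ⟨t, ht, s, hs, h1, h2⟩ := hm
    have hne : t ≠ s := fun h => h1 (h ▸ Precedes.refl t)
    -- Neither column precedes the other, so the one of larger level may be taken as the left one.
    rcases le_total (level s) (level t) with h | h
    · exact ⟨t, ht, s, hs, h, h1, hne⟩
    · exact ⟨s, hs, t, ht, h, h2, hne.symm⟩
  obtain ⟨m', rfl⟩ : ∃ m', m = m' + (Finsupp.single t 1 + Finsupp.single s 1) := by
    refine ⟨m - (Finsupp.single t 1 + Finsupp.single s 1), (tsub_add_cancel_of_le ?_).symm⟩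
    intro x
    rw [Finsupp.mem_support_iff] at ht hs
    simp only [Finsupp.add_apply, Finsupp.single_apply]
    split_ifs with h1 h2 h2
    · exact absurd (h1.trans h2.symm) hne
    · subst h1; omega
    · subst h2; omega
    · omega
  have hmul : ∀ t s : Tuple n, monomial (m' + (Finsupp.single t 1 + Finsupp.single s 1)) (1 : ℂ) =
      monomial m' 1 * (X t * X s) := by
    intro t s
    simp only [X, monomial_mul, mul_one]
  rw [hmul]
  obtain ⟨f, hf, g, hg, hfg⟩ := Submodule.mem_sup.1 (X_mul_X_mem_of_not_precedes hl hts)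
  rw [← hfg, mul_add]
  refine Q.add_mem ((le_sup_left : _ ≤ Q) (Ideal.mul_mem_left _ _ hf)) ?_
  clear hfg
  induction hg using Submodule.span_induction with
  | zero => simp
  | add x y _ _ hx hy => rw [mul_add]; exact Q.add_mem hx hy
  | smul a x _ hx => rw [mul_smul_comm]; exact Q.smul_mem a hx
  | mem x hx =>
    obtain ⟨t', s', hlt, rfl⟩ := hx
    rw [← hmul]
    refine ih _ ?_ _ rfl
    have h1 := totalLevel_le (m' + (Finsupp.single t' 1 + Finsupp.single s' 1))
    subst hN
    simp only [map_add, totalLevel_single, Finsupp.degree_single] at h1 ⊢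
    push_cast at h1 ⊢
    rw [Int.toNat_lt_toNat] <;> linarith

/-! ### Monomials of strictly maximal weight -/

section Lead

variable {σ : Type*} (w : σ → ℕ)

/-- The monomial with exponent `e` is the only monomial of maximal weight in `f`. -/
def IsLead (f : MvPolynomial σ ℂ) (e : σ →₀ ℕ) : Prop :=
  coeff e f ≠ 0 ∧ ∀ d, coeff d f ≠ 0 → d ≠ e → Finsupp.weight w d < Finsupp.weight w e

variable {w}

theorem IsLead.weight_le {f : MvPolynomial σ ℂ} {e d : σ →₀ ℕ} (h : IsLead w f e)
    (hd : coeff d f ≠ 0) : Finsupp.weight w d ≤ Finsupp.weight w e := by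
  by_cases hde : d = e
  · rw [hde]
  · exact (h.2 d hd hde).le

theorem IsLead.eq_of_weight_le {f : MvPolynomial σ ℂ} {e d : σ →₀ ℕ} (h : IsLead w f e)
    (hd : coeff d f ≠ 0) (hw : Finsupp.weight w e ≤ Finsupp.weight w d) : d = e := by
  by_contra hde
  exact (h.2 d hd hde).not_ge hw

theorem IsLead.one : IsLead w (1 : MvPolynomial σ ℂ) 0 := by
  classical
  refine ⟨by simp, fun d hd hde => ?_⟩
  rw [coeff_one, if_neg (Ne.symm hde)] at hd
  exact absurd rfl hd

/-- Weight is additive, so a pair of terms reaching the top weight consists of the two leading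
terms. No cancellation can occur there. -/
theorem IsLead.mul {f g : MvPolynomial σ ℂ} {d e : σ →₀ ℕ} (hf : IsLead w f d)
    (hg : IsLead w g e) : IsLead w (f * g) (d + e) := by
  classical
  have key : ∀ x y, coeff x f * coeff y g ≠ 0 →
      Finsupp.weight w (d + e) ≤ Finsupp.weight w (x + y) → x = d ∧ y = e := by
    intro x y hxy hle
    simp only [map_add] at hle
    have h1 := hf.weight_le (left_ne_zero_of_mul hxy)
    have h2 := hg.weight_le (right_ne_zero_of_mul hxy)
    exact ⟨hf.eq_of_weight_le (left_ne_zero_of_mul hxy) (by omega),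
      hg.eq_of_weight_le (right_ne_zero_of_mul hxy) (by omega)⟩
  constructor
  · rw [coeff_mul, Finset.sum_eq_single (d, e)]
    · exact mul_ne_zero hf.1 hg.1
    · intro x hx hne
      by_contra h
      exact hne (Prod.ext_iff.2 (key x.1 x.2 h
        (by rw [Finset.HasAntidiagonal.mem_antidiagonal.1 hx])))
    · intro h
      simp at h
  · intro c hc hne
    rw [coeff_mul] at hc
    obtain ⟨x, hx, hx0⟩ := Finset.exists_ne_zero_of_sum_ne_zero hc
    rw [← Finset.HasAntidiagonal.mem_antidiagonal.1 hx] at hne ⊢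
    by_contra! h
    obtain ⟨h1, h2⟩ := key x.1 x.2 hx0 h
    exact hne (by rw [h1, h2])

theorem IsLead.pow {f : MvPolynomial σ ℂ} {e : σ →₀ ℕ} (hf : IsLead w f e) (a : ℕ) :
    IsLead w (f ^ a) (a • e) := by
  induction a with
  | zero => simpa using IsLead.one
  | succ a ih => rw [pow_succ, succ_nsmul]; exact ih.mul hf

theorem IsLead.finset_prod {ι : Type*} (s : Finset ι) (f : ι → MvPolynomial σ ℂ)
    (e : ι → σ →₀ ℕ) (h : ∀ i ∈ s, IsLead w (f i) (e i)) :
    IsLead w (∏ i ∈ s, f i) (∑ i ∈ s, e i) := by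
  classical
  induction s using Finset.induction_on with
  | empty => simpa using IsLead.one
  | insert a s ha ih =>
    rw [Finset.prod_insert ha, Finset.sum_insert ha]
    exact (h a (Finset.mem_insert_self a s)).mul
      (ih fun i hi => h i (Finset.mem_insert_of_mem hi))

theorem IsLead.sign_mul {f : MvPolynomial σ ℂ} {e : σ →₀ ℕ} (hf : IsLead w f e) (ε : ℤˣ) :
    IsLead w (((ε : ℤ) : MvPolynomial σ ℂ) * f) e := by
  rcases Int.units_eq_one_or ε with rfl | rfl
  · simpa using hf
  · simpa [IsLead] using hf

theorem isLead_sum_monomial {ι : Type*} [Fintype ι] (E : ι → σ →₀ ℕ) (b : ι → ℂ) (i : ι)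
    (hb : b i ≠ 0) (hE : ∀ j, j ≠ i → Finsupp.weight w (E j) < Finsupp.weight w (E i)) :
    IsLead w (∑ j, monomial (E j) (b j)) (E i) := by
  classical
  constructor
  · rw [coeff_sum, Finset.sum_eq_single i]
    · simpa using hb
    · intro j _ hj
      rw [coeff_monomial, if_neg]
      intro h
      exact (hE j hj).ne (by rw [h])
    · simp
  · intro d hd hne
    rw [coeff_sum] at hd
    obtain ⟨j, -, hj⟩ := Finset.exists_ne_zero_of_sum_ne_zero hd
    rw [coeff_monomial] at hj
    split_ifs at hj with h
    · subst h
      exact hE j fun hji => hne (by rw [hji])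
    · exact absurd rfl hj

end Lead

/-! ### Diagonal terms of the minors -/

/-- The weight of the matrix entry `z_{i,j}`. -/
def entryWeight (p : Fin n × Idx n) : ℕ := p.1 * kingPos p.2

/-- The exponent of the diagonal term of the minor of a tuple, sorted by `kingPos`. -/
noncomputable def diagExp (t : Tuple n) : Fin n × Idx n →₀ ℕ :=
  ∑ c, Finsupp.single (Fin.castLE t.1.isLt c, sortedCol t c) 1

/-- This settles the equality case of the rearrangement inequality: the inverse of `σ` is
increasing, hence the identity. -/
theorem perm_eq_one_of_monovary {m : ℕ} {f : Fin m → ℕ} (hf : StrictMono f) (σ : Perm (Fin m))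
    (h : Monovary f fun c => (σ c : ℕ)) : σ = 1 := by
  have hs : StrictMono σ.symm := by
    apply Monotone.strictMono_of_injective _ σ.symm.injective
    intro a b hab
    rcases hab.eq_or_lt with rfl | hab
    · exact le_rfl
    · exact hf.le_iff_le.1 (h (by simpa using hab))
  have : (σ.symm : Fin m → Fin m) = id :=
    (StrictMono.range_inj hs strictMono_id).1 (by simp [σ.symm.surjective.range_eq])
  ext x
  have h2 := congrFun this (σ x)
  simp only [symm_apply_apply, id_eq] at h2
  rw [← h2]
  rfl

/-- With variables at all positions, every Leibniz term has a formal exponent, and the zeros of `Z`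
become zero coefficients. -/
theorem rename_matrixZ (i : Fin n) (j : Idx n) :
    rename Subtype.val (matrixZ n i j) =
      C (if (i : ℤ) + 1 ≤ |j.val| then 1 else 0) * X (i, j) := by
  have : (i : ℤ) + 1 ≤ |j.val| ↔ ((i : ℤ) + 1 ≤ j.val ∨ j.val ≤ -((i : ℤ) + 1)) := by
    rw [le_abs, le_neg]
  simp only [matrixZ, Matrix.of_apply, this]
  split_ifs with h <;> simp

/-- Otherwise the first c + 1 sorted entries all have absolute value at most c, against
admissibility for l = c. Thus the diagonal of the sorted minor avoids the zeros of `Z`. -/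
theorem Admissible.lt_abs_sortedCol {t : Tuple n} (ht : Admissible t.2) (c : Fin (t.1 + 1)) :
    (c : ℤ) + 1 ≤ |(sortedCol t c).val| := by
  by_contra! h
  have h0 : 0 < |(sortedCol t c).val| := abs_pos.2 (sortedCol t c).ne_zero
  have hcn : (c : ℕ) ≤ n := by have := c.isLt; have := t.1.isLt; omega
  have := ht c (by omega) hcn
  let τ := _root_.Tuple.sort (kingPos ∘ t.2)
  have hsub : (Finset.Iic c).map τ.toEmbedding ⊆
      Finset.univ.filter fun d => |(t.2 d).val| ≤ ((c : ℕ) : ℤ) := by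
    intro d hd
    obtain ⟨b, hb, rfl⟩ := Finset.mem_map.1 hd
    have hbc := abs_le_of_kingPos_le
      ((strictMono_sortedCol t).monotone (Finset.mem_Iic.1 hb))
    refine Finset.mem_filter.2 ⟨Finset.mem_univ _, ?_⟩
    change |(sortedCol t b).val| ≤ _
    omega
  have := (Finset.card_le_card hsub).trans this
  rw [Finset.card_map, Fin.card_Iic] at this
  omega

theorem isLead_minorD {t : Tuple n} (ht : Admissible t.2) :
    IsLead entryWeight (rename Subtype.val (minorD n t)) (diagExp t) := by
  let E : Perm (Fin (t.1 + 1)) → Fin n × Idx n →₀ ℕ := fun σ =>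
    ∑ c, Finsupp.single (Fin.castLE t.1.isLt (σ c), sortedCol t c) 1
  let b : Perm (Fin (t.1 + 1)) → ℂ := fun σ =>
    (Perm.sign σ : ℤ) * ∏ c, if (σ c : ℤ) + 1 ≤ |(sortedCol t c).val| then 1 else 0
  have hsort : rename Subtype.val
      ((matrixZ n).submatrix (Fin.castLE t.1.isLt) (sortedCol t)).det =
      ∑ σ, monomial (E σ) (b σ) := by
    rw [Matrix.det_apply, map_sum]
    refine Finset.sum_congr rfl fun σ _ => ?_
    rw [Units.smul_def, zsmul_eq_mul, map_mul, map_intCast, map_prod]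
    simp only [Matrix.submatrix_apply, rename_matrixZ, Fin.val_castLE]
    rw [Finset.prod_mul_distrib, ← map_prod, monomial_sum_index]
    simp only [b, C_mul, X, map_intCast, mul_assoc]
  have hlead : IsLead entryWeight (∑ σ, monomial (E σ) (b σ)) (E 1) := by
    apply isLead_sum_monomial
    · have : b 1 = 1 := by
        simp only [b, Perm.sign_one, Units.val_one, Int.cast_one, one_mul, Perm.one_apply]
        exact Finset.prod_eq_one fun c _ => if_pos (ht.lt_abs_sortedCol c)
      simp [this]
    · intro σ hσ
      have hw : ∀ σ, Finsupp.weight entryWeight (E σ) =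
          ∑ c, (kingPos ∘ sortedCol t) c * (σ c : ℕ) := by
        intro σ
        simp only [E, map_sum, Finsupp.weight_single, entryWeight, Fin.val_castLE, one_smul,
          Function.comp_apply, mul_comm]
      rw [hw, hw]
      -- The weight of the term of σ is the sum of `kingPos` of the c-th entry times σ(c); by
      -- rearrangement the identity maximizes it strictly.
      refine (Monovary.sum_mul_comp_perm_lt_sum_mul_iff (σ := σ)
        (f := kingPos ∘ sortedCol t) (g := fun c : Fin (t.1 + 1) => (c : ℕ)) ?_).2 ?_
      · intro i j hij
        exact (strictMono_sortedCol t).monotone (Fin.le_def.2 hij.le)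
      · exact fun h => hσ (perm_eq_one_of_monovary (strictMono_sortedCol t) σ h)
  rw [← hsort] at hlead
  have hperm := Matrix.det_permute' (_root_.Tuple.sort (kingPos ∘ t.2))
    ((matrixZ n).submatrix (Fin.castLE t.1.isLt) t.2)
  rw [Matrix.submatrix_submatrix] at hperm
  change ((matrixZ n).submatrix (Fin.castLE t.1.isLt) (sortedCol t)).det = _ at hperm
  rw [hperm, map_mul, map_intCast] at hlead
  have := hlead.sign_mul (Perm.sign (_root_.Tuple.sort (kingPos ∘ t.2)))
  rwa [← mul_assoc, sign_mul_self_cast, one_mul] at this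

/-- By pigeonhole: more than l columns vanish below row l, so every Leibniz term has a factor 0. -/
theorem minorD_eq_zero {t : Tuple n} (ht : ¬ Admissible t.2) : minorD n t = 0 := by
  simp only [Admissible, not_forall, not_le] at ht
  obtain ⟨l, -, -, hl⟩ := ht
  rw [minorD, Matrix.det_apply]
  refine Finset.sum_eq_zero fun σ _ => ?_
  obtain ⟨c, hc, hcl⟩ : ∃ c, |(t.2 c).val| ≤ (l : ℤ) ∧ l ≤ (σ c : ℕ) := by
    by_contra! h
    refine hl.not_ge ?_
    refine (Finset.card_le_card_of_injOn (t := Finset.range l) (fun c => (σ c : ℕ))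
      (fun c hc => ?_) fun a _ b _ hab => σ.injective (Fin.ext hab)).trans_eq (Finset.card_range l)
    simpa using h c (Finset.mem_filter.1 hc).2
  rw [Finset.prod_eq_zero (Finset.mem_univ c), smul_zero]
  rw [Matrix.submatrix_apply, matrixZ, Matrix.of_apply, dif_neg]
  rw [Fin.val_castLE, ← le_neg, ← le_abs]
  omega

/-! ### Row contents of semistandard tableaux -/

theorem weight_diagExp_ne_zero_iff (m : Tuple n →₀ ℕ) (i : Fin n) (j : Idx n) :
    Finsupp.weight diagExp m (i, j) ≠ 0 ↔
      ∃ t ∈ m.support, ∃ h : (i : ℕ) < t.1 + 1, sortedCol t ⟨i, h⟩ = j := by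
  have h1 : ∀ t : Tuple n, diagExp t (i, j) ≠ 0 ↔
      ∃ h : (i : ℕ) < t.1 + 1, sortedCol t ⟨i, h⟩ = j := by
    intro t
    simp only [diagExp, Finsupp.finsetSum_apply, ne_eq, Finset.sum_eq_zero_iff, not_forall,
      Finsupp.single_apply_eq_zero, Prod.mk.injEq, Finset.mem_univ, true_implies]
    constructor
    · rintro ⟨c, ⟨rfl, rfl⟩, -⟩
      exact ⟨c.isLt, rfl⟩
    · rintro ⟨h, rfl⟩
      exact ⟨⟨i, h⟩, ⟨rfl, rfl⟩, one_ne_zero⟩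
  rw [Finsupp.weight_apply, Finsupp.sum, Finsupp.finsetSum_apply, ne_eq, Finset.sum_eq_zero_iff]
  simp only [not_forall, ← h1, Finsupp.smul_apply, smul_eq_mul, mul_eq_zero, not_or,
    Finsupp.mem_support_iff]
  grind

theorem exists_forall_precedes {A : Finset (Tuple n)} (hA : A.Nonempty)
    (h : ∀ t ∈ A, ∀ s ∈ A, Precedes t s ∨ Precedes s t) : ∃ t ∈ A, ∀ s ∈ A, Precedes t s := by
  classical
  induction hA using Finset.Nonempty.cons_induction with
  | singleton a => exact ⟨a, by simp, by simp [Precedes.refl]⟩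
  | cons a A ha hA ih =>
    obtain ⟨t, ht, htA⟩ := ih fun t ht s hs =>
      h t (Finset.mem_cons_of_mem ht) s (Finset.mem_cons_of_mem hs)
    rcases h a (Finset.mem_cons_self a A) t (Finset.mem_cons_of_mem ht) with h | h
    · refine ⟨a, Finset.mem_cons_self a A, fun s hs => ?_⟩
      rcases Finset.mem_cons.1 hs with rfl | hs
      · exact Precedes.refl _
      · exact h.trans (htA s hs)
    · refine ⟨t, Finset.mem_cons_of_mem ht, fun s hs => ?_⟩
      rcases Finset.mem_cons.1 hs with rfl | hs
      · exact h
      · exact htA s hs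

/-- Each entry of `t'` occurs in the same row of some column of `m`, and `t` precedes all of those.
By symmetry, tableaux with equal row contents have equal first columns. -/
theorem precedes_of_weight_diagExp_eq {m m' : Tuple n →₀ ℕ}
    (h : Finsupp.weight diagExp m = Finsupp.weight diagExp m') {t t' : Tuple n}
    (ht : ∀ s ∈ m.support, Precedes t s) (ht' : t' ∈ m'.support) : Precedes t t' := by
  have key : ∀ (r : ℕ) (hr : r < t'.1 + 1), ∃ s ∈ m.support, ∃ h : r < s.1 + 1,
      sortedCol s ⟨r, h⟩ = sortedCol t' ⟨r, hr⟩ := by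
    intro r hr
    have hrn : r < n := hr.trans_le t'.1.isLt
    have := (weight_diagExp_ne_zero_iff m' ⟨r, hrn⟩ (sortedCol t' ⟨r, hr⟩)).2 ⟨t', ht', hr, rfl⟩
    rw [← h] at this
    exact (weight_diagExp_ne_zero_iff m _ _).1 this
  constructor
  · obtain ⟨s, hs, hr, -⟩ := key t'.1 (Nat.lt_succ_self _)
    exact (Fin.le_def.2 (Nat.lt_succ_iff.1 hr)).trans (ht s hs).1
  · intro r hr hr'
    obtain ⟨s, hs, hrs, heq⟩ := key r hr'
    rw [← heq]
    exact (ht s hs).2 r hr hrs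

theorem eq_zero_of_weight_diagExp_eq_zero {m : Tuple n →₀ ℕ}
    (h : Finsupp.weight diagExp m = 0) : m = 0 := by
  by_contra hm
  obtain ⟨t, ht⟩ := Finsupp.support_nonempty_iff.2 hm
  have := (weight_diagExp_ne_zero_iff m ⟨0, t.1.pos⟩ _).2 ⟨t, ht, Nat.succ_pos _, rfl⟩
  rw [h] at this
  exact this rfl

/-- A semistandard tableau is determined by the contents of its rows. -/
theorem IsStandard.eq_of_weight_diagExp_eq {m m' : Tuple n →₀ ℕ} (hm : IsStandard m)
    (hm' : IsStandard m') (h : Finsupp.weight diagExp m = Finsupp.weight diagExp m') :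
    m = m' := by
  induction hN : m.degree generalizing m m' with
  | zero =>
    obtain rfl := (Finsupp.degree_eq_zero_iff m).1 hN
    rw [map_zero] at h
    exact (eq_zero_of_weight_diagExp_eq_zero h.symm).symm
  | succ N ih =>
    have hm0 : m ≠ 0 := by rintro rfl; simp at hN
    have hm0' : m' ≠ 0 := by
      rintro rfl
      exact hm0 (eq_zero_of_weight_diagExp_eq_zero (by rw [h, map_zero]))
    obtain ⟨t, ht, htm⟩ := exists_forall_precedes (Finsupp.support_nonempty_iff.2 hm0) hm
    obtain ⟨t', ht', htm'⟩ := exists_forall_precedes (Finsupp.support_nonempty_iff.2 hm0') hm'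
    obtain rfl : t = t' := (precedes_of_weight_diagExp_eq h htm ht').antisymm
      (precedes_of_weight_diagExp_eq h.symm htm' ht)
    have hdec : ∀ m : Tuple n →₀ ℕ, t ∈ m.support → ∃ d, m = d + Finsupp.single t 1 := by
      intro m ht
      refine ⟨m - Finsupp.single t 1, (tsub_add_cancel_of_le ?_).symm⟩
      rw [Finsupp.single_le_iff]
      exact Nat.one_le_iff_ne_zero.2 (Finsupp.mem_support_iff.1 ht)
    have hst : ∀ d : Tuple n →₀ ℕ, IsStandard (d + Finsupp.single t 1) → IsStandard d := by
      intro d hd s hs u hu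
      refine hd s ?_ u ?_ <;> simp only [Finsupp.mem_support_iff, Finsupp.add_apply] at * <;> omega
    obtain ⟨d, rfl⟩ := hdec m ht
    obtain ⟨d', rfl⟩ := hdec m' ht'
    rw [ih (hst d hm) (hst d' hm') (by simpa using h) (by simpa using hN)]

theorem minorD_ne_zero {t : Tuple n} (ht : Admissible t.2) : minorD n t ≠ 0 := by
  intro h
  have := (isLead_minorD ht).1
  rw [h, map_zero, coeff_zero] at this
  exact this rfl

/-! ### The minors of `Z` satisfy the Plücker relations -/

/-- The tuple `(1, …, k + 1)`. -/
def initialTuple (k : Fin n) : Tuple n :=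
  ⟨k, OrderEmbedding.ofStrictMono
    (fun c => ⟨(c : ℤ) + 1, by omega, by
      have := c.isLt
      have := k.isLt
      rw [abs_of_pos (by omega)]
      omega⟩)
    (fun a b hab => by
      change Idx.pos _ < Idx.pos _
      have : (a : ℕ) < b := hab
      simp only [Idx.pos]
      split_ifs <;> omega)⟩

theorem admissible_initialTuple (k : Fin n) : Admissible (initialTuple k).2 := by
  intro l _ _
  refine (Finset.card_le_card_of_injOn (t := Finset.range l) (fun c : Fin (k + 1) => (c : ℕ))
    (fun c hc => ?_) Fin.val_injective.injOn).trans_eq (Finset.card_range l)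
  have h := (Finset.mem_filter.1 hc).2
  change |(c : ℤ) + 1| ≤ l at h
  rw [abs_of_pos (by omega)] at h
  change c.val ∈ (Finset.range l : Set ℕ)
  rw [Finset.coe_range, Set.mem_Iio]
  omega

/-- The minors of a matrix whose rows are linearly independent are Plücker coordinates of the flag
spanned by the rows. -/
theorem exists_isPluckerVector (A : Fin n → Idx n → ℂ) (hA : LinearIndependent ℂ A) :
    ∃ F : PartialFlag n, IsPluckerVector F fun t =>
      (Matrix.of fun a c => A (Fin.castLE t.1.isLt a) (t.2 c)).det := by
  have hk : ∀ k : Fin n, LinearIndependent ℂ fun a : Fin (k + 1) => A (Fin.castLE k.isLt a) :=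
    fun k => hA.comp _ (Fin.castLE_injective _)
  refine ⟨⟨fun k => Submodule.span ℂ (Set.range fun a : Fin (k + 1) => A (Fin.castLE k.isLt a)),
    fun k l hkl => Submodule.span_mono ?_, fun k => ?_⟩, fun k => ?_⟩
  · rintro _ ⟨a, rfl⟩
    exact ⟨Fin.castLE (Nat.succ_le_succ hkl) a, rfl⟩
  · rw [finrank_span_eq_card (hk k), Fintype.card_fin]
  · refine ⟨Module.Basis.span (hk k), fun t => ?_⟩
    simp only [Module.Basis.span_apply]

/-- The rows of `Z` at a point z span a flag only if they are independent. Multiplying by a nonzero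
product of minors makes the other points harmless, and the factor cancels in a domain. -/
theorem aeval_minorD_of_mem_pluckerIdeal {f : MvPolynomial (Tuple n) ℂ}
    (hf : f ∈ pluckerIdeal n) : aeval (minorD n) f = 0 := by
  have hg : (∏ k : Fin n, minorD n (initialTuple k)) ≠ 0 :=
    Finset.prod_ne_zero_iff.2 fun k _ => minorD_ne_zero (admissible_initialTuple k)
  refine (mul_eq_zero.1 (?_ : (∏ k : Fin n, minorD n (initialTuple k)) *
    aeval (minorD n) f = 0)).resolve_left hg
  refine MvPolynomial.funext fun z => ?_
  rw [map_mul, map_zero, map_prod, mul_eq_zero, or_iff_not_imp_left]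
  intro hz
  let A : Fin n → Idx n → ℂ := fun i j => eval z (matrixZ n i j)
  have hD : ∀ t : Tuple n, eval z (minorD n t) =
      (Matrix.of fun a c => A (Fin.castLE t.1.isLt a) (t.2 c)).det := by
    intro t
    rw [minorD, RingHom.map_det]
    rfl
  have hA : LinearIndependent ℂ A := by
    rcases n with _ | N
    · exact linearIndependent_empty_type
    have hlast := Finset.prod_ne_zero_iff.1 hz (Fin.last N) (Finset.mem_univ _)
    rw [hD] at hlast
    have := Matrix.linearIndependent_rows_of_det_ne_zero hlast
    exact LinearIndependent.of_comp (LinearMap.funLeft ℂ ℂ (initialTuple (Fin.last N)).2) this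
  obtain ⟨F, hF⟩ := exists_isPluckerVector A hA
  have := mem_vanishingIdeal_iff.1 hf _ ⟨F, hF⟩
  simp only [← hD] at this
  rw [← this, ← coe_aeval_eq_eval, AlgHom.coe_toRingHom, ← AlgHom.comp_apply, comp_aeval]

theorem minorHom_comp_proj : (minorHom n).comp (proj n) = aeval (minorD n) := by
  refine MvPolynomial.algHom_ext fun t => ?_
  rw [AlgHom.comp_apply, proj, aeval_X, aeval_X]
  split_ifs with h
  · rw [minorHom, aeval_X]
  · rw [map_zero, minorD_eq_zero h]

theorem isLead_aeval_monomial {m : Tuple n →₀ ℕ} (hm : ∀ t ∈ m.support, Admissible t.2) :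
    IsLead entryWeight (rename Subtype.val (aeval (minorD n) (monomial m (1 : ℂ))))
      (Finsupp.weight diagExp m) := by
  rw [aeval_monomial, map_one, one_mul, Finsupp.prod, map_prod, Finsupp.weight_apply, Finsupp.sum]
  refine IsLead.finset_prod _ _ _ fun t ht => ?_
  rw [map_pow]
  exact (isLead_minorD (hm t ht)).pow _

theorem aeval_monomial_eq_zero {R : Type*} [CommRing R] [Algebra ℂ R] (p : Tuple n → R)
    (hp : ∀ t : Tuple n, ¬ Admissible t.2 → p t = 0) {m : Tuple n →₀ ℕ}
    (hm : ¬ ∀ t ∈ m.support, Admissible t.2) (a : ℂ) : aeval p (monomial m a) = 0 := by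
  simp only [not_forall] at hm
  obtain ⟨t, ht, hta⟩ := hm
  rw [aeval_monomial, Finsupp.prod, Finset.prod_eq_zero ht, mul_zero]
  rw [hp t hta, zero_pow (Finsupp.mem_support_iff.1 ht)]

/-! ### Linear independence and the conclusion -/

/-- The products of minors of `Z` belonging to standard monomials in admissible variables are
linearly independent. -/
theorem coeff_eq_zero_of_aeval_minorD_eq_zero {g : MvPolynomial (Tuple n) ℂ}
    (hg : ∀ m ∈ g.support, IsStandard m) (h0 : aeval (minorD n) g = 0) {m : Tuple n →₀ ℕ}
    (hm : ∀ t ∈ m.support, Admissible t.2) : coeff m g = 0 := by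
  classical
  by_contra hne
  let A := g.support.filter fun m => ∀ t ∈ m.support, Admissible t.2
  have hA : A.Nonempty := ⟨m, Finset.mem_filter.2 ⟨mem_support_iff.2 hne, hm⟩⟩
  obtain ⟨d, hdA, hd⟩ := Finset.exists_max_image A
    (fun m => Finsupp.weight entryWeight (Finsupp.weight diagExp m)) hA
  obtain ⟨hdg, hda⟩ := Finset.mem_filter.1 hdA
  have hlead := isLead_aeval_monomial hda
  -- Let `d` have the heaviest leading term. If `c` also contributes to that exponent, the exponent
  -- must be the leading one of `c`, so `c` and `d` have the same row contents and coincide.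
  have hsum : coeff (Finsupp.weight diagExp d)
      (rename Subtype.val (aeval (minorD n) g)) = coeff d g * coeff (Finsupp.weight diagExp d)
        (rename Subtype.val (aeval (minorD n) (monomial d (1 : ℂ)))) := by
    have hmon : ∀ c, monomial c (coeff c g) = coeff c g • monomial c (1 : ℂ) := by
      intro c
      rw [smul_monomial, smul_eq_mul, mul_one]
    conv_lhs => rw [g.as_sum]
    rw [map_sum, map_sum, coeff_sum, Finset.sum_eq_single d]
    · rw [hmon, map_smul, map_smul, coeff_smul, smul_eq_mul]
    · intro c hc hcd
      by_cases hca : ∀ t ∈ c.support, Admissible t.2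
      · rw [hmon, map_smul, map_smul, coeff_smul, smul_eq_mul]
        by_contra h
        refine hcd ((hg c hc).eq_of_weight_diagExp_eq (hg d hdg) ?_)
        exact ((isLead_aeval_monomial hca).eq_of_weight_le (right_ne_zero_of_mul h)
          (hd c (Finset.mem_filter.2 ⟨hc, hca⟩))).symm
      · rw [aeval_monomial_eq_zero _ (fun t => minorD_eq_zero) hca, map_zero, coeff_zero]
    · exact fun h => absurd hdg h
  rw [h0, map_zero, coeff_zero] at hsum
  exact mul_ne_zero (mem_support_iff.1 hdg) hlead.1 hsum.symm

/-- Every polynomial is congruent modulo the Plücker ideal to a combination of standard monomials. -/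
theorem exists_sub_mem_pluckerIdeal (f : MvPolynomial (Tuple n) ℂ) :
    ∃ g : MvPolynomial (Tuple n) ℂ, (∀ m ∈ g.support, IsStandard m) ∧ f - g ∈ pluckerIdeal n := by
  have hf : f ∈ (pluckerIdeal n).restrictScalars ℂ ⊔
      Submodule.span ℂ ((fun m => monomial m (1 : ℂ)) '' {m : Tuple n →₀ ℕ | IsStandard m}) := by
    rw [f.as_sum]
    refine Submodule.sum_mem _ fun m _ => ?_
    have := Submodule.smul_mem _ (coeff m f) (monomial_mem_sup_span_standard m)
    rwa [smul_monomial, smul_eq_mul, mul_one] at this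
  obtain ⟨i, hi, g, hg, rfl⟩ := Submodule.mem_sup.1 hf
  refine ⟨g, ?_, by simpa using hi⟩
  have hle : Submodule.span ℂ ((fun m => monomial m (1 : ℂ)) '' {m : Tuple n →₀ ℕ | IsStandard m}) ≤
      restrictSupport ℂ {m : Tuple n →₀ ℕ | IsStandard m} := by
    rw [Submodule.span_le]
    rintro _ ⟨m, hm, rfl⟩
    rw [SetLike.mem_coe, mem_restrictSupport_iff]
    intro d hd
    rwa [Finset.mem_singleton.1 (support_monomial_subset hd)]
  exact (mem_restrictSupport_iff ℂ).1 (hle hg)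

end TypeCFlag

theorem mainTheorem6 (n : ℕ) (hn : 2 ≤ n) :
    TypeCFlag.intermediateIdeal n = RingHom.ker (TypeCFlag.minorHom n) := by
  open TypeCFlag MvPolynomial in
  have hcomp : ∀ f, minorHom n (proj n f) = aeval (minorD n) f :=
    fun f => DFunLike.congr_fun minorHom_comp_proj f
  apply le_antisymm
  · rw [intermediateIdeal, Ideal.map_le_iff_le_comap]
    intro f hf
    rw [Ideal.mem_comap, RingHom.mem_ker, hcomp, aeval_minorD_of_mem_pluckerIdeal hf]
  · intro q hq
    obtain ⟨f, rfl⟩ := proj_surjective n q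
    rw [RingHom.mem_ker, hcomp] at hq
    obtain ⟨g, hg, hfg⟩ := exists_sub_mem_pluckerIdeal f
    have hg0 : aeval (minorD n) g = 0 := by
      rw [← sub_eq_zero.1 ((map_sub _ f g).symm.trans (aeval_minorD_of_mem_pluckerIdeal hfg)), hq]
    have hpg : proj n g = 0 := by
      rw [g.as_sum, map_sum]
      refine Finset.sum_eq_zero fun m _ => ?_
      by_cases hm : ∀ t ∈ m.support, Admissible t.2
      · rw [coeff_eq_zero_of_aeval_minorD_eq_zero hg hg0 hm, monomial_zero, map_zero]
      · exact aeval_monomial_eq_zero _ (fun t ht => dif_neg ht) hm _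
    have := Ideal.mem_map_of_mem (proj n) hfg
    rwa [map_sub, hpg, sub_zero] at this
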